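/- Let $k$ be a field of characteristic zero and let $L$ be any Lie algebra over $k$ (of finite or infinite dimension), with enveloping algebra $U(L)$ and canonical map $\iota : L \to U(L)$. Regard $U(L)$ as a bialgebra with unit $\eta$, counit $\epsilon$ (the algebra homomorphism with $\epsilon(\iota(\ell))=0$ for $\ell \in L$) and coproduct $\Delta$ (the algebra homomorphism with $\Delta(\iota(\ell)) = 1\otimes \iota(\ell) + \iota(\ell)\otimes 1$). For linear maps $f,g : U(L)\to U(L)$ let $f\star g = \mu\circ(f\otimes g)\circ\Delta$ be the convolution product, where $\mu$ is the multiplication of $U(L)$. Let $J = \mathrm{id} - \eta\circ\epsilon$, and let $$e = J - \frac{J^{\star 2}}{2} + \frac{J^{\star 3}}{3} - \cdots : U(L)\to U(L)$$ be the Eulerian idempotent (on each element of $U(L)$ only finitely many terms are nonzero). Let $T^c(L)=\bigoplus_{n\ge 0}L^{\otimes n}$ be the tensor coalgebra, with the deconcatenation coproduct $l_1\otimes\cdots\otimes l_n\mapsto\sum_{i=0}^n (l_1\otimes\cdots\otimes l_i)\otimes(l_{i+1}\otimes\cdots\otimes l_n)$ and with the projection to $L^{\otimes 0}=k$ as counit.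 Let $\mathrm{Sym}^c(L)\subseteq T^c(L)$ be the subcoalgebra spanned by the symmetrized tensors $\sum_{\sigma\in S_n} l_{\sigma(1)}\otimes\cdots\otimes l_{\sigma(n)}$ with $n \ge 0$ and $l_1,\dots,l_n\in L$, and let $\pi:\mathrm{Sym}^c(L)\to L$ be the projection to tensor degree one. Then $\iota$ is injective and the image of $e$ lies in $\iota(L)$, so that $e$ may be regarded as a linear map $U(L)\to L$. There is exactly one homomorphism of coalgebras $\alpha : U(L)\to \mathrm{Sym}^c(L)$ with $\pi\circ\alpha = e$, and $\alpha$ is an isomorphism of coalgebras. -/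

import Mathlib

open scoped TensorProduct

attribute [local instance 100] LieRing.ofAssociativeRing

noncomputable section

/-! ### Spanning by products of generators -/

namespace EulerPBW

theorem span_list_prod_eq_top {k L A : Type*} [CommSemiring k] [Semiring A] [Algebra k A]
    (f : L → A) (h : Algebra.adjoin k (Set.range f) = ⊤) :
    Submodule.span k (Set.range fun l : List L => (l.map f).prod) = ⊤ := by
  rw [eq_top_iff, ← Algebra.top_toSubmodule, ← h, Algebra.adjoin_eq_span]
  refine Submodule.span_mono ?_
  intro x hx
  obtain ⟨l, hl, rfl⟩ := Submonoid.exists_list_of_mem_closure hx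
  clear hx
  induction l with
  | nil => exact ⟨[], by simp⟩
  | cons a t ih =>
    obtain ⟨m, hm⟩ := ih (fun y hy => hl y (List.mem_cons_of_mem _ hy))
    obtain ⟨b, hb⟩ := hl a List.mem_cons_self
    exact ⟨b :: m, by simp only [List.map_cons, List.prod_cons] at hm ⊢; rw [hm, hb]⟩

end EulerPBW

/-! ### The bialgebra structure of the universal enveloping algebra -/

namespace UniversalEnvelopingAlgebra

section Bialgebra

variable (k L : Type*) [CommRing k] [LieRing L] [LieAlgebra k L]

variable {k L} in
theorem hom_ext_ι {A : Type*} [Ring A] [Algebra k A] {f g : UniversalEnvelopingAlgebra k L →ₐ[k] A}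
    (h : ∀ x, f (ι k x) = g (ι k x)) : f = g :=
  hom_ext k (LieHom.ext h)

/-- The coproduct of `U(L)`: the algebra homomorphism with `ℓ ↦ 1 ⊗ ℓ + ℓ ⊗ 1`. -/
def comulHom : UniversalEnvelopingAlgebra k L →ₐ[k]
    UniversalEnvelopingAlgebra k L ⊗[k] UniversalEnvelopingAlgebra k L :=
  lift k
    { toFun := fun x => 1 ⊗ₜ[k] ι k x + ι k x ⊗ₜ[k] 1
      map_add' := fun x y => by
        simp only [map_add, TensorProduct.tmul_add, TensorProduct.add_tmul]; abel
      map_smul' := fun r x => by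
        simp only [map_smul, TensorProduct.tmul_smul, TensorProduct.smul_tmul', smul_add,
          RingHom.id_apply]
      map_lie' := fun {x y} => by
        simp only [LieHom.map_lie, LieRing.of_associative_ring_bracket, mul_add, add_mul,
          Algebra.TensorProduct.tmul_mul_tmul, one_mul, mul_one, TensorProduct.tmul_sub,
          TensorProduct.sub_tmul]
        abel }

/-- The counit of `U(L)`: the algebra homomorphism that vanishes on `L`. -/
def counitHom : UniversalEnvelopingAlgebra k L →ₐ[k] k := lift k 0

theorem comulHom_ι (x : L) : comulHom k L (ι k x) = 1 ⊗ₜ[k] ι k x + ι k x ⊗ₜ[k] 1 :=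
  lift_ι_apply k _ x

theorem counitHom_ι (x : L) : counitHom k L (ι k x) = 0 := lift_ι_apply k _ x

instance instBialgebra : Bialgebra k (UniversalEnvelopingAlgebra k L) :=
  .ofAlgHom (comulHom k L) (counitHom k L)
    (by
      refine hom_ext_ι fun x => ?_
      simp only [AlgHom.comp_apply, comulHom_ι, map_add,
        Algebra.TensorProduct.map_tmul, map_one, AlgHom.id_apply, Algebra.TensorProduct.one_def,
        TensorProduct.add_tmul, TensorProduct.tmul_add, AlgEquiv.toAlgHom_apply,
        Algebra.TensorProduct.assoc_tmul]
      abel)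
    (by
      refine hom_ext_ι fun x => ?_
      simp [-ι_apply, comulHom_ι, counitHom_ι])
    (by
      refine hom_ext_ι fun x => ?_
      simp [-ι_apply, comulHom_ι, counitHom_ι])

theorem comul_ι (x : L) :
    Coalgebra.comul (R := k) (ι k x) = 1 ⊗ₜ[k] ι k x + ι k x ⊗ₜ[k] 1 :=
  comulHom_ι k L x

theorem counit_ι (x : L) : Coalgebra.counit (R := k) (ι k x) = 0 := counitHom_ι k L x

theorem adjoin_range_ι : Algebra.adjoin k (Set.range (ι k : L → _)) =
    (⊤ : Subalgebra k (UniversalEnvelopingAlgebra k L)) := by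
  have hs : Function.Surjective (mkAlgHom k L) := RingCon.mkₐ_surjective _
  have h := congrArg (Subalgebra.map (mkAlgHom k L)) (TensorAlgebra.adjoin_range_ι (R := k) (M := L))
  rw [AlgHom.map_adjoin, ← Set.range_comp, Algebra.map_top, (AlgHom.range_eq_top _).2 hs] at h
  exact h

theorem span_list_prod :
    Submodule.span k (Set.range fun l : List L => (l.map (ι k)).prod) =
      (⊤ : Submodule k (UniversalEnvelopingAlgebra k L)) :=
  EulerPBW.span_list_prod_eq_top _ (adjoin_range_ι k L)

end Bialgebra

/-! ### The Eulerian idempotent -/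

section Eulerian

open WithConv

variable (k L : Type*) [Field k] [LieRing L] [LieAlgebra k L]

/-- `J = 𝟏 - η ∘ ε` in the convolution algebra of linear endomorphisms of `U(L)`; here `𝟏` is
the identity map, and `η ∘ ε` is the unit `1` of the convolution product. -/
def convJ : WithConv (UniversalEnvelopingAlgebra k L →ₗ[k] UniversalEnvelopingAlgebra k L) :=
  toConv LinearMap.id - 1

theorem convJ_apply (u : UniversalEnvelopingAlgebra k L) :
    convJ k L u = u - algebraMap k _ (Coalgebra.counit (R := k) u) := rfl

theorem comul_list_prod (l : List L) :
    Coalgebra.comul (R := k) (l.map (ι k)).prod - 1 ⊗ₜ[k] (l.map (ι k)).prod ∈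
      Submodule.span k {t : UniversalEnvelopingAlgebra k L ⊗[k] UniversalEnvelopingAlgebra k L |
        ∃ (a : UniversalEnvelopingAlgebra k L) (m : List L), m.length < l.length ∧
          t = a ⊗ₜ[k] (m.map (ι k)).prod} := by
  induction l with
  | nil => simp [Algebra.TensorProduct.one_def]
  | cons x l ih =>
    set S := Submodule.span k
      {t : UniversalEnvelopingAlgebra k L ⊗[k] UniversalEnvelopingAlgebra k L |
        ∃ (a : UniversalEnvelopingAlgebra k L) (m : List L), m.length < (x :: l).length ∧
          t = a ⊗ₜ[k] (m.map (ι k)).prod} with hS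
    have key : ∀ r ∈ Submodule.span k
        {t : UniversalEnvelopingAlgebra k L ⊗[k] UniversalEnvelopingAlgebra k L |
        ∃ (a : UniversalEnvelopingAlgebra k L) (m : List L), m.length < l.length ∧
          t = a ⊗ₜ[k] (m.map (ι k)).prod},
        (1 ⊗ₜ[k] ι k x) * r ∈ S ∧ (ι k x ⊗ₜ[k] 1) * r ∈ S := by
      intro r hr
      induction hr using Submodule.span_induction with
      | mem r hr =>
        obtain ⟨a, m, hm, rfl⟩ := hr
        constructor
        · exact Submodule.subset_span ⟨a, x :: m, by simpa using hm, by simp [-ι_apply]⟩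
        · exact Submodule.subset_span ⟨ι k x * a, m, by simp; omega, by simp [-ι_apply]⟩
      | zero => simp
      | add a b _ _ ha hb =>
        rw [mul_add, mul_add]
        exact ⟨S.add_mem ha.1 hb.1, S.add_mem ha.2 hb.2⟩
      | smul c a _ ha =>
        rw [mul_smul_comm, mul_smul_comm]
        exact ⟨S.smul_mem _ ha.1, S.smul_mem _ ha.2⟩
    obtain ⟨h1, h2⟩ := key _ ih
    have h3 : (ι k x) ⊗ₜ[k] (l.map (ι k)).prod ∈ S :=
      Submodule.subset_span ⟨ι k x, l, by simp, rfl⟩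
    have : Coalgebra.comul (R := k) ((x :: l).map (ι k)).prod
        - 1 ⊗ₜ[k] ((x :: l).map (ι k)).prod
        = (1 ⊗ₜ[k] ι k x) * (Coalgebra.comul (R := k) (l.map (ι k)).prod
            - 1 ⊗ₜ[k] (l.map (ι k)).prod)
          + (ι k x ⊗ₜ[k] 1) * (Coalgebra.comul (R := k) (l.map (ι k)).prod
            - 1 ⊗ₜ[k] (l.map (ι k)).prod)
          + (ι k x) ⊗ₜ[k] (l.map (ι k)).prod := by
      rw [List.map_cons, List.prod_cons, Bialgebra.comul_mul, comul_ι]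
      simp only [mul_sub, add_mul, Algebra.TensorProduct.tmul_mul_tmul, one_mul, mul_one]
      abel
    rw [this]
    exact S.add_mem (S.add_mem h1 h2) h3

theorem convJ_pow_list_prod (m : ℕ) (l : List L) (h : l.length < m) :
    (convJ k L ^ m) (l.map (ι k)).prod = 0 := by
  induction m generalizing l with
  | zero => omega
  | succ m ih =>
    rw [pow_succ', LinearMap.convMul_apply]
    have h1 : convJ k L (1 : UniversalEnvelopingAlgebra k L) = 0 := by
      rw [convJ_apply, Bialgebra.counit_one, map_one, sub_self]
    have h2 := comul_list_prod k L l
    set F := LinearMap.mul' k (UniversalEnvelopingAlgebra k L) ∘ₗ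
      TensorProduct.map (convJ k L).ofConv (convJ k L ^ m).ofConv with hF
    have h3 : ∀ t ∈ Submodule.span k
        {t : UniversalEnvelopingAlgebra k L ⊗[k] UniversalEnvelopingAlgebra k L |
        ∃ (a : UniversalEnvelopingAlgebra k L) (m : List L), m.length < l.length ∧
          t = a ⊗ₜ[k] (m.map (ι k)).prod}, F t = 0 := by
      intro t ht
      induction ht using Submodule.span_induction with
      | mem t ht =>
        obtain ⟨a, n, hn, rfl⟩ := ht
        have h4 := ih n (by omega)
        change convJ k L a * (convJ k L ^ m) (n.map (ι k)).prod = 0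
        rw [h4, mul_zero]
      | zero => simp
      | add a b _ _ ha hb => rw [map_add, ha, hb, add_zero]
      | smul c a _ ha => rw [map_smul, ha, smul_zero]
    have h5 := h3 _ h2
    rw [map_sub, sub_eq_zero] at h5
    change F _ = 0
    rw [h5]
    change convJ k L 1 * _ = 0
    rw [h1, zero_mul]

/-- The convolution powers of `J` vanish eventually at each element of `U(L)`. -/
theorem exists_convJ_pow_eq_zero (u : UniversalEnvelopingAlgebra k L) :
    ∃ N, ∀ m, N ≤ m → (convJ k L ^ m) u = 0 := by
  have hu : u ∈ Submodule.span k (Set.range fun l : List L => (l.map (ι k)).prod) := by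
    rw [span_list_prod]; trivial
  induction hu using Submodule.span_induction with
  | mem u hu =>
    obtain ⟨l, rfl⟩ := hu
    exact ⟨l.length + 1, fun m hm => convJ_pow_list_prod k L m l (by omega)⟩
  | zero => exact ⟨0, fun m _ => map_zero (convJ k L ^ m).ofConv⟩
  | add a b _ _ ha hb =>
    obtain ⟨N, hN⟩ := ha
    obtain ⟨M, hM⟩ := hb
    refine ⟨max N M, fun m hm => ?_⟩
    have : (convJ k L ^ m) (a + b) = (convJ k L ^ m) a + (convJ k L ^ m) b :=
      map_add (convJ k L ^ m).ofConv a b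
    rw [this, hN m (by omega), hM m (by omega), add_zero]
  | smul c a _ ha =>
    obtain ⟨N, hN⟩ := ha
    refine ⟨N, fun m hm => ?_⟩
    have : (convJ k L ^ m) (c • a) = c • (convJ k L ^ m) a :=
      map_smul (convJ k L ^ m).ofConv c a
    rw [this, hN m hm, smul_zero]

theorem finite_support_eulerian (u : UniversalEnvelopingAlgebra k L) :
    (Function.support fun n : ℕ =>
      ((-1 : k) ^ n / (n + 1 : k)) • (convJ k L ^ (n + 1)) u).Finite := by
  obtain ⟨N, hN⟩ := exists_convJ_pow_eq_zero k L u
  refine (Set.finite_lt_nat N).subset fun n hn => ?_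
  by_contra h
  simp only [Set.mem_ofPred_eq, not_lt] at h
  exact hn (by simp [hN (n + 1) (by omega)])

/-- The Eulerian idempotent `e = J - J^{⋆2}/2 + J^{⋆3}/3 - ⋯` of `U(L)`. At each element of
`U(L)` only finitely many terms are nonzero, see `finite_support_eulerian`. -/
def eulerian : UniversalEnvelopingAlgebra k L →ₗ[k] UniversalEnvelopingAlgebra k L where
  toFun u := ∑ᶠ n : ℕ, ((-1 : k) ^ n / (n + 1 : k)) • (convJ k L ^ (n + 1)) u
  map_add' a b := by
    rw [← finsum_add_distrib (finite_support_eulerian k L a) (finite_support_eulerian k L b)]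
    refine finsum_congr fun n => ?_
    rw [← smul_add]
    exact congrArg _ (map_add (convJ k L ^ (n + 1)).ofConv a b)
  map_smul' c a := by
    rw [RingHom.id_apply, smul_finsum' c (finite_support_eulerian k L a)]
    refine finsum_congr fun n => ?_
    rw [smul_comm c]
    exact congrArg _ (map_smul (convJ k L ^ (n + 1)).ofConv c a)

end Eulerian

end UniversalEnvelopingAlgebra

/-! ### The tensor coalgebra -/

namespace TensorAlgebra

section Deconcatenation

variable (k V : Type*) [Field k] [AddCommGroup V] [Module k V]

/-- The pair `(w, Δ w)` determines the pair `(x w, Δ (x w))` for `x ∈ V`, through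
`Δ (x w) = 1 ⊗ x w + (x ⊗ 1) Δ w`. -/
def deconcStep : V →ₗ[k] Module.End k
    (TensorAlgebra k V × (TensorAlgebra k V ⊗[k] TensorAlgebra k V)) :=
  LinearMap.mk₂ k
    (fun x p => (ι k x * p.1, 1 ⊗ₜ[k] (ι k x * p.1) + (ι k x ⊗ₜ[k] 1) * p.2))
    (fun x y p => by
      simp only [map_add, add_mul, TensorProduct.tmul_add, TensorProduct.add_tmul, Prod.mk_add_mk]
      congr 1; abel)
    (fun c x p => by
      simp only [map_smul, smul_mul_assoc, TensorProduct.tmul_smul, ← TensorProduct.smul_tmul',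
        Prod.smul_mk, smul_add])
    (fun x p q => by
      simp only [Prod.fst_add, Prod.snd_add, mul_add, TensorProduct.tmul_add, Prod.mk_add_mk]
      congr 1; abel)
    (fun c x p => by
      simp only [Prod.smul_fst, Prod.smul_snd, mul_smul_comm, TensorProduct.tmul_smul,
        Prod.smul_mk, smul_add])

theorem deconcStep_apply (x : V)
    (p : TensorAlgebra k V × (TensorAlgebra k V ⊗[k] TensorAlgebra k V)) :
    deconcStep k V x p = (ι k x * p.1, 1 ⊗ₜ[k] (ι k x * p.1) + (ι k x ⊗ₜ[k] 1) * p.2) := rfl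

/-- The deconcatenation coproduct on the tensor algebra,
`x₁⋯xₙ ↦ ∑ᵢ x₁⋯xᵢ ⊗ xᵢ₊₁⋯xₙ` (see `deconc_list_prod`). -/
def deconc : TensorAlgebra k V →ₗ[k] TensorAlgebra k V ⊗[k] TensorAlgebra k V :=
  LinearMap.snd k _ _ ∘ₗ (lift k (deconcStep k V)).toLinearMap.flip (1, 1 ⊗ₜ[k] 1)

theorem span_list_prod :
    Submodule.span k (Set.range fun l : List V => (l.map (ι k)).prod) =
      (⊤ : Submodule k (TensorAlgebra k V)) :=
  EulerPBW.span_list_prod_eq_top _ adjoin_range_ι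

variable {k V} in
theorem linearMap_ext_list {N : Type*} [AddCommGroup N] [Module k N]
    {f g : TensorAlgebra k V →ₗ[k] N}
    (h : ∀ l : List V, f (l.map (ι k)).prod = g (l.map (ι k)).prod) : f = g :=
  LinearMap.ext_on_range (span_list_prod k V) h

theorem deconc_one : deconc k V 1 = 1 ⊗ₜ[k] 1 := by
  simp [deconc]

theorem lift_deconcStep_fst (w : TensorAlgebra k V) :
    (lift k (deconcStep k V) w (1, 1 ⊗ₜ[k] 1)).1 = w := by
  suffices h : LinearMap.fst k _ _ ∘ₗ
      (lift k (deconcStep k V)).toLinearMap.flip (1, 1 ⊗ₜ[k] 1) = LinearMap.id from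
    LinearMap.congr_fun h w
  refine linearMap_ext_list fun l => ?_
  induction l with
  | nil => simp
  | cons x l ih =>
    simp only [LinearMap.comp_apply, LinearMap.flip_apply, AlgHom.toLinearMap_apply,
      LinearMap.fst_apply, LinearMap.id_apply, List.map_cons, List.prod_cons, map_mul,
      lift_ι_apply, Module.End.mul_apply] at ih ⊢
    rw [deconcStep_apply, ih]

theorem deconc_ι_mul (x : V) (w : TensorAlgebra k V) :
    deconc k V (ι k x * w) = 1 ⊗ₜ[k] (ι k x * w) + (ι k x ⊗ₜ[k] 1) * deconc k V w := by
  have h := lift_deconcStep_fst k V w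
  simp only [deconc, LinearMap.comp_apply, LinearMap.flip_apply, AlgHom.toLinearMap_apply,
      LinearMap.snd_apply, map_mul, lift_ι_apply, Module.End.mul_apply]
  rw [deconcStep_apply, h]

theorem deconc_list_prod (l : List V) :
    deconc k V (l.map (ι k)).prod = ∑ i ∈ Finset.range (l.length + 1),
      ((l.take i).map (ι k)).prod ⊗ₜ[k] ((l.drop i).map (ι k)).prod := by
  induction l with
  | nil => simp [deconc_one]
  | cons x l ih =>
    rw [List.map_cons, List.prod_cons, deconc_ι_mul, ih, List.length_cons,
      Finset.sum_range_succ' _ (l.length + 1), add_comm, Finset.mul_sum]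
    simp

theorem deconc_coassoc :
    (TensorProduct.assoc k _ _ _).toLinearMap ∘ₗ (deconc k V).rTensor _ ∘ₗ deconc k V =
      (deconc k V).lTensor _ ∘ₗ deconc k V := by
  have key : ∀ (x : V) (d : TensorAlgebra k V ⊗[k] TensorAlgebra k V),
      TensorProduct.assoc k _ _ _ ((deconc k V).rTensor _ ((ι k x ⊗ₜ[k] 1) * d)) =
        1 ⊗ₜ[k] ((ι k x ⊗ₜ[k] 1) * d) + (ι k x ⊗ₜ[k] (1 ⊗ₜ[k] 1)) *
          TensorProduct.assoc k _ _ _ ((deconc k V).rTensor _ d) := by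
    intro x d
    induction d using TensorProduct.induction_on with
    | zero => simp
    | tmul a b =>
      have h : ∀ t : TensorAlgebra k V ⊗[k] TensorAlgebra k V,
          TensorProduct.assoc k _ _ _ (((ι k x ⊗ₜ[k] 1) * t) ⊗ₜ[k] b) =
          (ι k x ⊗ₜ[k] (1 ⊗ₜ[k] 1)) * TensorProduct.assoc k _ _ _ (t ⊗ₜ[k] b) := by
        intro t
        induction t using TensorProduct.induction_on with
        | zero => simp
        | tmul c d => simp
        | add c d hc hd => simp only [mul_add, TensorProduct.add_tmul, map_add, hc, hd]
      rw [Algebra.TensorProduct.tmul_mul_tmul, one_mul, LinearMap.rTensor_tmul, deconc_ι_mul,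
        TensorProduct.add_tmul, map_add, h, LinearMap.rTensor_tmul]
      simp
    | add a b ha hb =>
      simp only [mul_add, map_add, TensorProduct.tmul_add] at ha hb ⊢
      rw [ha, hb]; abel
  have key2 : ∀ (x : V) (d : TensorAlgebra k V ⊗[k] TensorAlgebra k V),
      (deconc k V).lTensor (TensorAlgebra k V) ((ι k x ⊗ₜ[k] 1) * d) =
        (ι k x ⊗ₜ[k] (1 ⊗ₜ[k] 1)) * (deconc k V).lTensor _ d := by
    intro x d
    induction d using TensorProduct.induction_on with
    | zero => simp
    | tmul a b => simp [← Algebra.TensorProduct.one_def]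
    | add a b ha hb => simp only [mul_add, map_add, ha, hb]
  refine linearMap_ext_list fun l => ?_
  induction l with
  | nil => simp [deconc_one]
  | cons x l ih =>
    simp only [LinearMap.comp_apply, LinearEquiv.coe_coe, List.map_cons, List.prod_cons] at ih ⊢
    rw [deconc_ι_mul, map_add, map_add, key, ih, map_add, key2, LinearMap.lTensor_tmul,
      deconc_ι_mul, LinearMap.rTensor_tmul, deconc_one, TensorProduct.tmul_add,
      TensorProduct.assoc_tmul, add_assoc]

/-- The tensor coalgebra `T^c(V)`: the vector space `⨁ₙ V^{⊗ n}` with the deconcatenation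
coproduct and with the projection to `V^{⊗ 0} = k` as counit. -/
@[reducible] def tensorCoalgebra : Coalgebra k (TensorAlgebra k V) where
  comul := deconc k V
  counit := algebraMapInv.toLinearMap
  coassoc := deconc_coassoc k V
  rTensor_counit_comp_comul := by
    have key : ∀ (x : V) (d : TensorAlgebra k V ⊗[k] TensorAlgebra k V),
        (algebraMapInv (R := k) (M := V)).toLinearMap.rTensor (TensorAlgebra k V)
          ((ι k x ⊗ₜ[k] 1) * d) = 0 := by
      intro x d
      induction d using TensorProduct.induction_on with
      | zero => simp
      | tmul a b => simp [algebraMapInv]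
      | add a b ha hb => simp only [mul_add, map_add, ha, hb, add_zero]
    refine linearMap_ext_list fun l => ?_
    induction l with
    | nil => simp [deconc_one]
    | cons x l ih =>
      rw [LinearMap.comp_apply, List.map_cons, List.prod_cons, deconc_ι_mul, map_add, key]
      simp
  lTensor_counit_comp_comul := by
    have key : ∀ (x : V) (d : TensorAlgebra k V ⊗[k] TensorAlgebra k V),
        (algebraMapInv (R := k) (M := V)).toLinearMap.lTensor (TensorAlgebra k V)
          ((ι k x ⊗ₜ[k] 1) * d) = (ι k x ⊗ₜ[k] 1) *
        (algebraMapInv (R := k) (M := V)).toLinearMap.lTensor (TensorAlgebra k V) d := by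
      intro x d
      induction d using TensorProduct.induction_on with
      | zero => simp
      | tmul a b => simp
      | add a b ha hb => simp only [mul_add, map_add, ha, hb]
    refine linearMap_ext_list fun l => ?_
    induction l with
    | nil => simp [deconc_one]
    | cons x l ih =>
      rw [LinearMap.comp_apply] at ih
      rw [LinearMap.comp_apply, List.map_cons, List.prod_cons, deconc_ι_mul, map_add, key, ih]
      simp [algebraMapInv]

end Deconcatenation

/-! ### The coalgebra of symmetrized tensors -/

section Symmetrized

variable (k V : Type*) [Field k] [AddCommGroup V] [Module k V]

/-- `Sym^c(V)` as a vector space: the subspace of the tensor algebra spanned by the symmetrized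
tensors `∑_σ l_{σ(1)} ⊗ ⋯ ⊗ l_{σ(n)}`. -/
def symTensors : Submodule k (TensorAlgebra k V) :=
  Submodule.span k {t | ∃ (n : ℕ) (l : Fin n → V),
    t = ∑ σ : Equiv.Perm (Fin n), tprod k V n fun i => l (σ i)}

variable {k V}

theorem sum_neg_one_pow_card_superset {n : ℕ} (A : Finset (Fin n)) :
    ∑ s : Finset (Fin n), (if A ⊆ s then (-1 : ℤ) ^ s.card else 0) =
      if A = Finset.univ then (-1 : ℤ) ^ n else 0 := by
  split_ifs with h
  · subst h
    rw [Finset.sum_eq_single Finset.univ]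
    · simp
    · intro s _ hs
      rw [if_neg]
      intro h; exact hs (Finset.univ_subset_iff.1 h)
    · simp
  · obtain ⟨a, ha⟩ : ∃ a, a ∉ A := by
      by_contra! hc; exact h (Finset.eq_univ_iff_forall.2 hc)
    refine Finset.sum_involution (fun s _ => if a ∈ s then s.erase a else insert a s) ?_ ?_ ?_ ?_
    · intro s _
      by_cases has : a ∈ s
      · have h1 : A ⊆ s.erase a ↔ A ⊆ s :=
          ⟨fun h => h.trans (Finset.erase_subset _ _), fun h x hx =>
            Finset.mem_erase.2 ⟨fun hxa => ha (hxa ▸ hx), h hx⟩⟩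
        have h2 := Finset.card_erase_add_one has
        simp only [has, if_true, h1]
        split_ifs
        · rw [← h2, pow_succ]; ring
        · simp
      · have h1 : A ⊆ insert a s ↔ A ⊆ s :=
          ⟨fun h x hx => (Finset.mem_insert.1 (h hx)).resolve_left fun hxa => ha (hxa ▸ hx),
            fun h => h.trans (Finset.subset_insert _ _)⟩
        simp only [has, if_false, h1, Finset.card_insert_of_notMem has]
        split_ifs
        · rw [pow_succ]; ring
        · simp
    · intro s _ _ hs
      by_cases has : a ∈ s
      · simp only [has, if_true] at hs
        have h3 : a ∈ s.erase a := by rw [hs]; exact has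
        exact Finset.notMem_erase a s h3
      · simp only [has, if_false] at hs
        exact has (hs ▸ Finset.mem_insert_self a s)
    · intros; simp
    · intro s _
      by_cases has : a ∈ s
      · simp [has]
      · simp [has]

/-- The polarization identity. -/
theorem polarization {n : ℕ} (l : Fin n → V) :
    ∑ s : Finset (Fin n), ((-1 : ℤ) ^ s.card) • tprod k V n (fun _ => ∑ i ∈ s, l i) =
      ((-1 : ℤ) ^ n) • ∑ σ : Equiv.Perm (Fin n), tprod k V n fun i => l (σ i) := by
  classical
  have h1 : ∀ s : Finset (Fin n), ((-1 : ℤ) ^ s.card) • tprod k V n (fun _ => ∑ i ∈ s, l i) =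
      ∑ f : Fin n → Fin n, (if Finset.univ.image f ⊆ s then (-1 : ℤ) ^ s.card else 0) •
        tprod k V n fun i => l (f i) := by
    intro s
    rw [MultilinearMap.map_sum_finset (tprod k V n) (fun _ j => l j) (fun _ => s),
      Finset.smul_sum, ← Finset.sum_filter_add_sum_filter_not Finset.univ
        (fun f : Fin n → Fin n => f ∈ Fintype.piFinset fun _ => s)]
    rw [Finset.sum_eq_zero (s := Finset.univ.filter
      (fun f : Fin n → Fin n => ¬ f ∈ Fintype.piFinset fun _ => s)), add_zero]
    · refine Finset.sum_congr (by ext; simp) fun f hf => ?_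
      rw [if_pos]
      intro x hx
      obtain ⟨i, _, rfl⟩ := Finset.mem_image.1 hx
      simp only [Finset.mem_filter, Fintype.mem_piFinset] at hf
      exact hf.2 i
    · intro f hf
      rw [if_neg, zero_smul]
      intro h
      simp only [Finset.mem_filter, Fintype.mem_piFinset] at hf
      exact hf.2 fun i => h (Finset.mem_image_of_mem f (Finset.mem_univ i))
  simp_rw [h1]
  rw [Finset.sum_comm]
  simp_rw [← Finset.sum_smul, sum_neg_one_pow_card_superset]
  rw [Finset.smul_sum]
  symm
  refine Finset.sum_of_injOn (fun σ : Equiv.Perm (Fin n) => (σ : Fin n → Fin n)) ?_ ?_ ?_ ?_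
  · intro σ _ τ _ h; exact Equiv.coe_fn_injective h
  · intro _ _; simp
  · intro f _ hf
    rw [if_neg, zero_smul]
    intro h
    have hs : Function.Surjective f := fun y => by
      have := h ▸ Finset.mem_univ y
      obtain ⟨x, _, hx⟩ := Finset.mem_image.1 this
      exact ⟨x, hx⟩
    exact hf ⟨Equiv.ofBijective f (Finite.surjective_iff_bijective.1 hs), by simp, rfl⟩
  · intro σ _
    rw [if_pos (Finset.image_univ_of_surjective σ.surjective)]

theorem tprod_const (n : ℕ) (x : V) : tprod k V n (fun _ => x) = ι k x ^ n := by
  simp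

theorem symTensors_le_span_pow :
    symTensors k V ≤ Submodule.span k {t | ∃ (n : ℕ) (x : V), t = ι k x ^ n} := by
  refine Submodule.span_le.2 ?_
  rintro _ ⟨n, l, rfl⟩
  have h := polarization (k := k) l
  have h2 : ((-1 : ℤ) ^ n) • (((-1 : ℤ) ^ n) •
      ∑ σ : Equiv.Perm (Fin n), tprod k V n fun i => l (σ i)) =
      ∑ σ : Equiv.Perm (Fin n), tprod k V n fun i => l (σ i) := by
    rw [smul_smul, ← mul_pow]; simp
  rw [SetLike.mem_coe, ← h2, ← h]
  refine zsmul_mem (Submodule.sum_mem _ fun s _ => zsmul_mem (Submodule.subset_span ?_) _) _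
  exact ⟨n, ∑ i ∈ s, l i, tprod_const n _⟩

theorem deconc_ι_pow (n : ℕ) (x : V) :
    deconc k V (ι k x ^ n) = ∑ i ∈ Finset.range (n + 1), (ι k x ^ i) ⊗ₜ[k] (ι k x ^ (n - i)) := by
  have h := deconc_list_prod k V (List.replicate n x)
  simp only [List.map_replicate, List.prod_replicate, List.length_replicate, List.take_replicate,
    List.drop_replicate] at h
  rw [h]
  refine Finset.sum_congr rfl fun i hi => ?_
  rw [min_eq_left (Nat.lt_succ_iff.1 (Finset.mem_range.1 hi))]

theorem map_subtype_injective :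
    Function.Injective (TensorProduct.map (symTensors k V).subtype (symTensors k V).subtype) := by
  exact TensorProduct.map_injective_of_flat_flat _ _ (Submodule.subtype_injective _)
    (Submodule.subtype_injective _)

variable [CharZero k]

theorem ι_pow_mem_symTensors (n : ℕ) (x : V) : ι k x ^ n ∈ symTensors k V := by
  have h : ∑ _σ : Equiv.Perm (Fin n), tprod k V n (fun _ => x) ∈ symTensors k V :=
    Submodule.subset_span ⟨n, fun _ => x, rfl⟩
  rw [Finset.sum_const, Finset.card_univ, Fintype.card_perm, Fintype.card_fin, tprod_const,
    ← Nat.cast_smul_eq_nsmul k] at h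
  exact (Submodule.smul_mem_iff _ (Nat.cast_ne_zero.2 n.factorial_ne_zero)).1 h

theorem deconc_mem_range (t : symTensors k V) :
    deconc k V t ∈ LinearMap.range
      (TensorProduct.map (symTensors k V).subtype (symTensors k V).subtype) := by
  have ht := symTensors_le_span_pow t.2
  generalize (t : TensorAlgebra k V) = t at ht
  induction ht using Submodule.span_induction with
  | mem t ht =>
    obtain ⟨n, x, rfl⟩ := ht
    rw [deconc_ι_pow]
    refine Submodule.sum_mem _ fun i _ => ?_
    exact ⟨⟨_, ι_pow_mem_symTensors i x⟩ ⊗ₜ[k] ⟨_, ι_pow_mem_symTensors (n - i) x⟩, rfl⟩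
  | zero => simp
  | add a b _ _ ha hb => rw [map_add]; exact Submodule.add_mem _ ha hb
  | smul c a _ ha => rw [map_smul]; exact Submodule.smul_mem _ c ha

variable (k V)

/-- The coproduct of `Sym^c(V)`: the restriction of the deconcatenation coproduct
(see `map_subtype_symComul`). -/
def symComul : symTensors k V →ₗ[k] symTensors k V ⊗[k] symTensors k V :=
  (LinearEquiv.ofInjective _ (map_subtype_injective (k := k) (V := V))).symm.toLinearMap ∘ₗ
    LinearMap.codRestrict _ (deconc k V ∘ₗ (symTensors k V).subtype) deconc_mem_range

theorem map_subtype_symComul :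
    TensorProduct.map (symTensors k V).subtype (symTensors k V).subtype ∘ₗ symComul k V =
      deconc k V ∘ₗ (symTensors k V).subtype := by
  ext1 t
  have := (LinearEquiv.ofInjective _ (map_subtype_injective (k := k) (V := V))).apply_symm_apply
    (LinearMap.codRestrict _ (deconc k V ∘ₗ (symTensors k V).subtype) deconc_mem_range t)
  exact congrArg Subtype.val this

theorem map_subtype_symComul_apply (t : symTensors k V) :
    TensorProduct.map (symTensors k V).subtype (symTensors k V).subtype (symComul k V t) =
      deconc k V t :=
  LinearMap.congr_fun (map_subtype_symComul k V) t

/-- The coalgebra `Sym^c(V)`: the subcoalgebra of the tensor coalgebra `T^c(V)` formed by the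
symmetrized tensors. -/
instance symCoalgebra : Coalgebra k (symTensors k V) where
  comul := symComul k V
  counit := algebraMapInv.toLinearMap ∘ₗ (symTensors k V).subtype
  coassoc := by
    have hinj : Function.Injective (TensorProduct.map (symTensors k V).subtype
        (TensorProduct.map (symTensors k V).subtype (symTensors k V).subtype)) :=
      TensorProduct.map_injective_of_flat_flat _ _ (Submodule.subtype_injective _)
        map_subtype_injective
    have h1 : ∀ d : symTensors k V ⊗[k] symTensors k V,
        TensorProduct.map (symTensors k V).subtype
          (TensorProduct.map (symTensors k V).subtype (symTensors k V).subtype)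
          (TensorProduct.assoc k _ _ _ ((symComul k V).rTensor _ d)) =
        TensorProduct.assoc k _ _ _ ((deconc k V).rTensor _
          (TensorProduct.map (symTensors k V).subtype (symTensors k V).subtype d)) := by
      intro d
      induction d using TensorProduct.induction_on with
      | zero => simp
      | tmul a b =>
        have h : ∀ t : symTensors k V ⊗[k] symTensors k V,
            TensorProduct.map (symTensors k V).subtype
              (TensorProduct.map (symTensors k V).subtype (symTensors k V).subtype)
              (TensorProduct.assoc k _ _ _ (t ⊗ₜ[k] b)) =
            TensorProduct.assoc k _ _ _ ((TensorProduct.map (symTensors k V).subtype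
              (symTensors k V).subtype t) ⊗ₜ[k] (b : TensorAlgebra k V)) := by
          intro t
          induction t using TensorProduct.induction_on with
          | zero => simp
          | tmul c d => simp
          | add c d hc hd => simp only [TensorProduct.add_tmul, map_add, hc, hd]
        rw [LinearMap.rTensor_tmul, h, map_subtype_symComul_apply, TensorProduct.map_tmul,
          LinearMap.rTensor_tmul]
        rfl
      | add a b ha hb => simp only [map_add, ha, hb]
    have h2 : ∀ d : symTensors k V ⊗[k] symTensors k V,
        TensorProduct.map (symTensors k V).subtype
          (TensorProduct.map (symTensors k V).subtype (symTensors k V).subtype)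
          ((symComul k V).lTensor _ d) =
        (deconc k V).lTensor _
          (TensorProduct.map (symTensors k V).subtype (symTensors k V).subtype d) := by
      intro d
      induction d using TensorProduct.induction_on with
      | zero => simp
      | tmul a b =>
        rw [LinearMap.lTensor_tmul, TensorProduct.map_tmul, map_subtype_symComul_apply,
          TensorProduct.map_tmul, LinearMap.lTensor_tmul]
        rfl
      | add a b ha hb => simp only [map_add, ha, hb]
    ext1 t
    apply hinj
    simp only [LinearMap.comp_apply, LinearEquiv.coe_coe]
    rw [h1, h2, map_subtype_symComul_apply]
    exact LinearMap.congr_fun (deconc_coassoc k V) t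
  rTensor_counit_comp_comul := by
    have hinj : Function.Injective ((symTensors k V).subtype.lTensor k) :=
      Module.Flat.lTensor_preserves_injective_linearMap _ (Submodule.subtype_injective _)
    have h1 : ∀ d : symTensors k V ⊗[k] symTensors k V,
        (symTensors k V).subtype.lTensor k
          ((algebraMapInv.toLinearMap ∘ₗ (symTensors k V).subtype).rTensor _ d) =
        algebraMapInv.toLinearMap.rTensor _
          (TensorProduct.map (symTensors k V).subtype (symTensors k V).subtype d) := by
      intro d
      induction d using TensorProduct.induction_on with
      | zero => simp
      | tmul a b => rfl
      | add a b ha hb => simp only [map_add, ha, hb]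
    ext1 t
    apply hinj
    rw [LinearMap.comp_apply, h1, map_subtype_symComul_apply]
    exact LinearMap.congr_fun (tensorCoalgebra k V).rTensor_counit_comp_comul t
  lTensor_counit_comp_comul := by
    have hinj : Function.Injective ((symTensors k V).subtype.rTensor k) :=
      Module.Flat.rTensor_preserves_injective_linearMap _ (Submodule.subtype_injective _)
    have h1 : ∀ d : symTensors k V ⊗[k] symTensors k V,
        (symTensors k V).subtype.rTensor k
          ((algebraMapInv.toLinearMap ∘ₗ (symTensors k V).subtype).lTensor _ d) =
        algebraMapInv.toLinearMap.lTensor _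
          (TensorProduct.map (symTensors k V).subtype (symTensors k V).subtype d) := by
      intro d
      induction d using TensorProduct.induction_on with
      | zero => simp
      | tmul a b => rfl
      | add a b ha hb => simp only [map_add, ha, hb]
    ext1 t
    apply hinj
    rw [LinearMap.comp_apply, h1, map_subtype_symComul_apply]
    exact LinearMap.congr_fun (tensorCoalgebra k V).lTensor_counit_comp_comul t

/-- The inclusion of `Sym^c(V)` into the tensor coalgebra is a homomorphism of coalgebras. -/
def symInclusion :
    letI := tensorCoalgebra k V
    symTensors k V →ₗc[k] TensorAlgebra k V :=
  letI := tensorCoalgebra k V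
  { (symTensors k V).subtype with
    counit_comp := rfl
    map_comp_comul := map_subtype_symComul k V }

end Symmetrized

section Projection

variable (k V : Type*) [Field k] [AddCommGroup V] [Module k V]

/-- The canonical projection `Sym^c(V) → V` onto the component of tensor degree one
(see `symProj_one` and `symProj_symmetrized`). -/
def symProj : symTensors k V →ₗ[k] V := ιInv ∘ₗ (symTensors k V).subtype

theorem ιInv_tprod {n : ℕ} (hn : n ≠ 1) (l : Fin n → V) : ιInv (tprod k V n l) = 0 := by
  let : Module kᵐᵒᵖ V := Module.compHom _ ((RingHom.id k).fromOpposite mul_comm)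
  have : IsCentralScalar k V := ⟨fun r m => rfl⟩
  change (toTrivSqZeroExt (tprod k V n l)).snd = 0
  rcases n with _ | _ | n
  · simp
  · exact absurd rfl hn
  · rw [tprod_apply, List.ofFn_succ, List.ofFn_succ, List.prod_cons, List.prod_cons, ← mul_assoc,
      map_mul, map_mul, toTrivSqZeroExt_ι, toTrivSqZeroExt_ι, TrivSqZeroExt.inr_mul_inr, zero_mul,
      TrivSqZeroExt.snd_zero]

theorem symProj_symmetrized {n : ℕ} (hn : n ≠ 1) (l : Fin n → V) :
    symProj k V ⟨∑ σ : Equiv.Perm (Fin n), tprod k V n fun i => l (σ i),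
      Submodule.subset_span ⟨n, l, rfl⟩⟩ = 0 := by
  change ιInv (∑ σ : Equiv.Perm (Fin n), tprod k V n fun i => l (σ i)) = 0
  rw [map_sum]
  exact Finset.sum_eq_zero fun σ _ => ιInv_tprod k V hn _

theorem symProj_one (v : V) (h : ι k v ∈ symTensors k V) : symProj k V ⟨ι k v, h⟩ = v :=
  ι_leftInverse v

end Projection

end TensorAlgebra

end

/-! The bridge between the two coalgebras is symmetrization, `s : Sym^c(L) → U(L)`, which sends `x ⊗
⋯ ⊗ x` to `xⁿ/n!`; the map `α` is its inverse. In characteristic zero polarization makes the powers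
`x ⊗ ⋯ ⊗ x` span `Sym^c(L)`, and the powers `yⁿ` span `U(L)`, since reordering the factors of a
product only costs shorter products. So it suffices to compute on powers.

For fixed `y` the elements `yⁿ/n!` form a sequence of divided powers, on which convolution becomes
multiplication of power series (`convMul_apply_dividedPower`). There `J` is the series `exp X - 1`,
so `e` is `log (exp X) = X`: it fixes `y` and kills `yⁿ` for `n ≠ 1` (`eulerian_ι_pow`). Hence `e`
takes values in `ι(L)`.

Injectivity of `ι` is proved without the Poincaré–Birkhoff–Witt theorem. For a free Lie algebra `F`
the derivation that is the identity on generators is injective and factors through `U(F)`. For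
general `L = F/R`, an element of `F` whose image dies in `U(L)` lies in the ideal of `U(F)`
generated by `R`. Symmetrizing inside that ideal shows that `e` maps it to `ι(R)`
(`eulerian_list_prod_mem`). As `e` fixes `ι(F)`, the element is in `R`.

Finally, `s` is a surjective coalgebra map with `e ∘ s = π`. An element of `Sym^c(L)` is the sum of
its images under the convolution powers of `π`, taken in the tensor algebra. Convolution powers are
compatible with coalgebra maps, so these images depend only on `s t`, which makes `s` injective. The
same recovery of an element from the powers of `π` shows that a coalgebra map into `Sym^c(L)` is
determined by its composite with `π`. -/

noncomputable section

/-! ### Convolution powers on sequences of divided powers -/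

namespace EulerPBW

section DividedPower

open WithConv

variable {k C A : Type*} [Field k] [AddCommGroup C] [Module k C] [Coalgebra k C]
  [Ring A] [Algebra k A]

/-- On a sequence of divided powers `g`, convolution of linear maps of the form
`g n ↦ aₙ bⁿ` is multiplication of the generating power series of the coefficients `aₙ`. -/
theorem convMul_apply_dividedPower {g : ℕ → C}
    (hg : ∀ n, Coalgebra.comul (R := k) (g n) =
      ∑ p ∈ Finset.HasAntidiagonal.antidiagonal n, g p.1 ⊗ₜ[k] g p.2) {b : A}
    {f₁ f₂ : WithConv (C →ₗ[k] A)} {a₁ a₂ : PowerSeries k}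
    (h₁ : ∀ n, f₁ (g n) = PowerSeries.coeff n a₁ • b ^ n)
    (h₂ : ∀ n, f₂ (g n) = PowerSeries.coeff n a₂ • b ^ n) (n : ℕ) :
    (f₁ * f₂) (g n) = PowerSeries.coeff n (a₁ * a₂) • b ^ n := by
  rw [LinearMap.convMul_apply, hg, map_sum, map_sum, PowerSeries.coeff_mul, Finset.sum_smul]
  refine Finset.sum_congr rfl fun p hp => ?_
  have h : LinearMap.mul' k A (TensorProduct.map f₁.ofConv f₂.ofConv (g p.1 ⊗ₜ[k] g p.2)) =
    f₁ (g p.1) * f₂ (g p.2) := rfl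
  rw [h, h₁, h₂, smul_mul_smul_comm, ← pow_add, Finset.HasAntidiagonal.mem_antidiagonal.1 hp]

/-- The condition on the counit says that the convolution unit corresponds to the power series `1`,
which starts the induction. -/
theorem convPow_apply_dividedPower {g : ℕ → C}
    (hg : ∀ n, Coalgebra.comul (R := k) (g n) =
      ∑ p ∈ Finset.HasAntidiagonal.antidiagonal n, g p.1 ⊗ₜ[k] g p.2)
    (hg' : ∀ n, Coalgebra.counit (R := k) (g n) = if n = 0 then 1 else 0) {b : A}
    {f : WithConv (C →ₗ[k] A)} {a : PowerSeries k}
    (h : ∀ n, f (g n) = PowerSeries.coeff n a • b ^ n) (m n : ℕ) :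
    (f ^ m) (g n) = PowerSeries.coeff n (a ^ m) • b ^ n := by
  induction m generalizing n with
  | zero =>
    rw [pow_zero, pow_zero, LinearMap.convOne_apply, hg', PowerSeries.coeff_one]
    split_ifs with h0
    · simp [h0]
    · simp
  | succ m ih => rw [pow_succ, pow_succ, convMul_apply_dividedPower hg ih h]

/-- Precomposition with a coalgebra homomorphism is a homomorphism of convolution algebras. -/
theorem convPow_apply_coalgHom {D : Type*} [AddCommGroup D] [Module k D] [Coalgebra k D]
    (f : WithConv (D →ₗ[k] A)) (φ : C →ₗc[k] D) (m : ℕ) (c : C) :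
    (f ^ m) (φ c) = ((toConv (f.ofConv ∘ₗ φ.toLinearMap) : WithConv (C →ₗ[k] A)) ^ m) c := by
  induction m generalizing c with
  | zero =>
    rw [pow_zero, pow_zero, LinearMap.convOne_apply, LinearMap.convOne_apply,
      CoalgHomClass.counit_comp_apply]
  | succ m ih =>
    have h := LinearMap.convMul_comp_coalgHom_distrib (f ^ m) f φ
    have h2 : (toConv ((f ^ m).ofConv ∘ₗ φ.toLinearMap) : WithConv (C →ₗ[k] A)) =
        (toConv (f.ofConv ∘ₗ φ.toLinearMap)) ^ m :=
      WithConv.ofConv_injective (LinearMap.ext ih)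
    rw [pow_succ, pow_succ, ← h2]
    exact LinearMap.congr_fun h c

end DividedPower

/-- The coefficients of `log (1 + (exp X - 1)) = X`. -/
theorem sum_coeff_log_exp (k : Type*) [Field k] [CharZero k] {n N : ℕ} (h : n ≤ N) :
    ∑ m ∈ Finset.range N, ((-1 : k) ^ m / (m + 1 : k)) *
      PowerSeries.coeff n ((PowerSeries.exp k - 1) ^ (m + 1)) = if n = 1 then 1 else 0 := by
  set E : PowerSeries k := PowerSeries.exp k - 1 with hE
  have hE0 : PowerSeries.constantCoeff E = 0 := by simp [hE]
  have hX : PowerSeries.X ∣ E := PowerSeries.X_dvd_iff.2 hE0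
  have hd : PowerSeries.derivative k E = 1 + E := by
    rw [hE, map_sub, PowerSeries.derivative_exp]; simp
  rcases n with _ | n
  · simp [hE0]
  set S : PowerSeries k := ∑ m ∈ Finset.range N, ((-1 : k) ^ m / (m + 1 : k)) • E ^ (m + 1) with hS
  -- As `E' = 1 + E`, differentiating the truncated logarithm termwise gives `1 + E` times a
  -- geometric sum in `-E`, which telescopes.
  have hdS : PowerSeries.derivative k S = 1 - (-E) ^ N := by
    rw [hS, map_sum]
    have : ∀ m ∈ Finset.range N, PowerSeries.derivative k
        (((-1 : k) ^ m / (m + 1 : k)) • E ^ (m + 1)) = (-E) ^ m * (1 + E) := by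
      intro m _
      have h0 : (m + 1 : k) ≠ 0 := by exact_mod_cast m.succ_ne_zero
      rw [Derivation.map_smul, Derivation.leibniz_pow, hd, Nat.add_sub_cancel, ← Nat.cast_smul_eq_nsmul k,
        smul_smul, Nat.cast_add, Nat.cast_one, div_mul_cancel₀ _ h0, neg_pow E, smul_eq_mul,
        ← smul_mul_assoc, Algebra.smul_def]
      simp
    rw [Finset.sum_congr rfl this, ← Finset.sum_mul]
    have := geom_sum_mul (-E) N
    linear_combination -this
  -- The index is now shifted, so `n < N`, and the error term `(-E) ^ N`, divisible by `X ^ N`, does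
  -- not reach degree `n`.
  have hc : PowerSeries.coeff n (PowerSeries.derivative k S) = if n = 0 then 1 else 0 := by
    rw [hdS, map_sub, PowerSeries.coeff_one, neg_pow]
    have : PowerSeries.X ^ N ∣ (-1) ^ N * E ^ N := (pow_dvd_pow_of_dvd hX N).mul_left _
    rw [PowerSeries.X_pow_dvd_iff.1 this n (by omega), sub_zero]
  rw [PowerSeries.coeff_derivative] at hc
  have hs : ∑ m ∈ Finset.range N, ((-1 : k) ^ m / (m + 1 : k)) *
      PowerSeries.coeff (n + 1) (E ^ (m + 1)) = PowerSeries.coeff (n + 1) S := by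
    simp [hS]
  rw [hs]
  have h0 : (n + 1 : k) ≠ 0 := by exact_mod_cast n.succ_ne_zero
  rcases n with _ | n
  · simpa using hc
  · rw [if_neg n.succ_ne_zero, mul_eq_zero, or_iff_left h0] at hc
    rw [hc, if_neg (by omega)]

end EulerPBW

/-! ### The Eulerian idempotent on powers -/

namespace UniversalEnvelopingAlgebra

section Powers

variable {k L : Type*} [Field k] [LieRing L] [LieAlgebra k L]

open scoped Nat

theorem counit_dividedPower (y : L) (n : ℕ) :
    Coalgebra.counit (R := k) ((n ! : k)⁻¹ • ι k y ^ n) = if n = 0 then 1 else 0 := by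
  rw [map_smul, Bialgebra.counit_pow, counit_ι]
  split_ifs with h
  · simp [h]
  · simp [h]

variable [CharZero k]

/-- The binomial theorem applies because `y ⊗ 1` and `1 ⊗ y` commute; the factorials absorb the
binomial coefficients. -/
theorem comul_dividedPower (y : L) (n : ℕ) :
    Coalgebra.comul (R := k) ((n ! : k)⁻¹ • ι k y ^ n) = ∑ p ∈ Finset.HasAntidiagonal.antidiagonal n,
      ((p.1 ! : k)⁻¹ • ι k y ^ p.1) ⊗ₜ[k] ((p.2 ! : k)⁻¹ • ι k y ^ p.2) := by
  have hc : Commute (ι k y ⊗ₜ[k] (1 : UniversalEnvelopingAlgebra k L))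
      ((1 : UniversalEnvelopingAlgebra k L) ⊗ₜ[k] ι k y) := by
    rw [commute_iff_eq, Algebra.TensorProduct.tmul_mul_tmul, Algebra.TensorProduct.tmul_mul_tmul,
      one_mul, mul_one]
  rw [map_smul, Bialgebra.comul_pow, comul_ι, add_comm, hc.add_pow', Finset.smul_sum]
  refine Finset.sum_congr rfl fun p hp => ?_
  obtain rfl := Finset.HasAntidiagonal.mem_antidiagonal.1 hp
  rw [Algebra.TensorProduct.tmul_pow, Algebra.TensorProduct.tmul_pow, one_pow, one_pow,
    Algebra.TensorProduct.tmul_mul_tmul, mul_one, one_mul, ← Nat.cast_smul_eq_nsmul k,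
    TensorProduct.smul_tmul_smul, smul_smul, Nat.cast_add_choose]
  congr 1
  have h1 : (p.1 ! : k) ≠ 0 := Nat.cast_ne_zero.2 p.1.factorial_ne_zero
  have h2 : (p.2 ! : k) ≠ 0 := Nat.cast_ne_zero.2 p.2.factorial_ne_zero
  have h3 : ((p.1 + p.2)! : k) ≠ 0 := Nat.cast_ne_zero.2 (p.1 + p.2).factorial_ne_zero
  field_simp

/-- The identity corresponds to `exp X` and the convolution unit to `1`. -/
theorem convJ_dividedPower (y : L) (n : ℕ) : convJ k L ((n ! : k)⁻¹ • ι k y ^ n) =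
    PowerSeries.coeff n (PowerSeries.exp k - 1) • ι k y ^ n := by
  rw [convJ_apply, counit_dividedPower, map_sub, PowerSeries.coeff_exp, PowerSeries.coeff_one,
    sub_smul]
  split_ifs with h
  · simp [h]
  · simp

theorem eulerian_dividedPower (y : L) (n : ℕ) :
    eulerian k L ((n ! : k)⁻¹ • ι k y ^ n) = if n = 1 then ι k y else 0 := by
  have hp : ∀ m, (convJ k L ^ m) ((n ! : k)⁻¹ • ι k y ^ n) =
      PowerSeries.coeff n ((PowerSeries.exp k - 1) ^ m) • ι k y ^ n := fun m =>
    EulerPBW.convPow_apply_dividedPower (comul_dividedPower y) (counit_dividedPower y)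
      (convJ_dividedPower y) m n
  change ∑ᶠ m : ℕ, ((-1 : k) ^ m / (m + 1 : k)) • (convJ k L ^ (m + 1)) _ = _
  simp only [hp, smul_smul]
  have hX : PowerSeries.X ∣ PowerSeries.exp k - 1 := PowerSeries.X_dvd_iff.2 (by simp)
  -- The terms with `m ≥ n` vanish because `X ^ (m + 1)` divides `(exp X - 1) ^ (m + 1)`.
  rw [finsum_eq_sum_of_support_subset (s := Finset.range n), ← Finset.sum_smul,
    EulerPBW.sum_coeff_log_exp k le_rfl]
  · split_ifs with h
    · simp [h]
    · simp
  · intro m hm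
    rw [Finset.coe_range, Set.mem_Iio]
    by_contra! hle
    refine hm ?_
    beta_reduce
    rw [PowerSeries.X_pow_dvd_iff.1 (pow_dvd_pow_of_dvd hX (m + 1)) n (by omega), mul_zero,
      zero_smul]

theorem eulerian_ι_pow (y : L) (n : ℕ) :
    eulerian k L (ι k y ^ n) = if n = 1 then ι k y else 0 := by
  have h0 : (n ! : k) ≠ 0 := Nat.cast_ne_zero.2 n.factorial_ne_zero
  have h := eulerian_dividedPower (k := k) y n
  rw [map_smul, inv_smul_eq_iff₀ h0] at h
  rw [h]
  split_ifs with h1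
  · simp [h1]
  · simp

theorem eulerian_ι (y : L) : eulerian k L (ι k y) = ι k y := by
  simpa [-ι_apply] using eulerian_ι_pow (k := k) y 1

end Powers

end UniversalEnvelopingAlgebra

/-! ### Symmetrized products in the enveloping algebra -/

namespace EulerPBW

open UniversalEnvelopingAlgebra

variable {k L : Type*} [Field k] [LieRing L] [LieAlgebra k L]

/-- The span of the products of fewer than `n` elements of `L`, at least one of which lies in
the Lie ideal `R`. -/
def shortProducts (R : LieIdeal k L) (n : ℕ) : Submodule k (UniversalEnvelopingAlgebra k L) :=
  Submodule.span k {u | ∃ l : List L, l.length < n ∧ (∃ x ∈ l, x ∈ R) ∧ u = (l.map (ι k)).prod}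

/-- Swapping two adjacent factors costs a product in which they are replaced by their commutator. It
is shorter by one, and keeps a factor in `R` because `R` is an ideal. The prefix `p` lets the
induction on permutations move past a common head. -/
theorem prod_sub_prod_mem_of_perm (R : LieIdeal k L) {l l' : List L} (h : l.Perm l') :
    ∀ p : List L, (∃ x ∈ p ++ l, x ∈ R) →
      ((p ++ l).map (ι k)).prod - ((p ++ l').map (ι k)).prod ∈
        shortProducts R (p ++ l).length := by
  induction h with
  | nil => intro p _; rw [sub_self]; exact Submodule.zero_mem _
  | cons x _ ih =>
    intro p hp
    have := ih (p ++ [x]) (by simpa using hp)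
    simpa [-ι_apply] using this
  | swap x y l =>
    intro p hp
    have h1 : ((p ++ y :: x :: l).map (ι k)).prod - ((p ++ x :: y :: l).map (ι k)).prod =
        ((p ++ ⁅y, x⁆ :: l).map (ι k)).prod := by
      simp only [List.map_append, List.map_cons, List.prod_append, List.prod_cons,
        LieHom.map_lie, LieRing.of_associative_ring_bracket]
      noncomm_ring
    rw [h1]
    refine Submodule.subset_span ⟨_, by simp, ?_, rfl⟩
    obtain ⟨z, hz, hzR⟩ := hp
    simp only [List.mem_append, List.mem_cons] at hz
    rcases hz with hz | rfl | rfl | hz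
    · exact ⟨z, by simp [hz], hzR⟩
    · exact ⟨⁅z, x⁆, by simp, lie_mem_left k L R z x hzR⟩
    · exact ⟨⁅y, z⁆, by simp, lie_mem_right k L R y z hzR⟩
    · exact ⟨z, by simp [hz], hzR⟩
  | trans h₁ h₂ ih₁ ih₂ =>
    intro p hp
    have h3 := ih₂ p (by
      obtain ⟨x, hx, hxR⟩ := hp
      exact ⟨x, ((h₁.append_left p).mem_iff).1 hx, hxR⟩)
    rw [← (h₁.append_left p).length_eq] at h3
    simpa using Submodule.add_mem _ (ih₁ p hp) h3

/-- In characteristic zero, a submodule that contains the symmetrized products of elements of `L`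
with at least one factor in the Lie ideal `R` contains all products with a factor in `R`. -/
theorem list_prod_mem_of_symmetrized_mem [CharZero k] (R : LieIdeal k L)
    (S : Submodule k (UniversalEnvelopingAlgebra k L))
    (hS : ∀ (n : ℕ) (v : Fin n → L), (∃ i, v i ∈ R) →
      ∑ σ : Equiv.Perm (Fin n), (List.ofFn fun i => ι k (v (σ i))).prod ∈ S)
    (l : List L) (hl : ∃ x ∈ l, x ∈ R) : (l.map (ι k)).prod ∈ S := by
  induction hn : l.length using Nat.strong_induction_on generalizing l with
  | _ n ih =>
  subst hn
  have hW : shortProducts R l.length ≤ S := by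
    refine Submodule.span_le.2 ?_
    rintro _ ⟨m, hm, hmR, rfl⟩
    exact ih _ hm m hmR rfl
  have hv : ∃ i, l.get i ∈ R := by
    obtain ⟨x, hx, hxR⟩ := hl
    obtain ⟨i, rfl⟩ := List.mem_iff_get.1 hx
    exact ⟨i, hxR⟩
  -- Averaging: `n!` times the product is this sum of differences, made of shorter products already
  -- in `S`, plus the symmetrized product.
  have hsum : ∑ σ : Equiv.Perm (Fin l.length), ((l.map (ι k)).prod -
      (List.ofFn fun i => ι k (l.get (σ i))).prod) ∈ S := by
    refine Submodule.sum_mem _ fun σ _ => hW ?_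
    have hp : l.Perm (List.ofFn (l.get ∘ σ)) := by
      have := (σ.ofFn_comp_perm l.get).symm
      rwa [List.ofFn_get] at this
    have := prod_sub_prod_mem_of_perm R hp [] (by simpa using hl)
    rwa [List.nil_append, List.nil_append, List.map_ofFn] at this
  have h := Submodule.add_mem _ hsum (hS _ l.get hv)
  rw [← Finset.sum_add_distrib] at h
  simp only [sub_add_cancel] at h
  rw [Finset.sum_const, Finset.card_univ, Fintype.card_perm, Fintype.card_fin,
    ← Nat.cast_smul_eq_nsmul k] at h
  exact (Submodule.smul_mem_iff _ (Nat.cast_ne_zero.2 (Nat.factorial_ne_zero _))).1 h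

/-- Symmetrized products are linear combinations of powers. -/
theorem symmetrized_mem_span_pow {n : ℕ} (v : Fin n → L) :
    ∑ σ : Equiv.Perm (Fin n), (List.ofFn fun i => ι k (v (σ i))).prod ∈
      Submodule.span k (Set.range fun y : L => ι k y ^ n) := by
  -- The polarization identity holds in the tensor algebra and is pushed forward to `U(L)`.
  have h := congrArg (TensorAlgebra.lift k (ι k : L →ₗ⁅k⁆ UniversalEnvelopingAlgebra k L).toLinearMap)
    (TensorAlgebra.polarization (k := k) v)
  simp only [TensorAlgebra.tprod_const] at h
  simp only [map_sum (TensorAlgebra.lift k _), map_zsmul, map_pow, TensorAlgebra.lift_ι_apply,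
    LieHom.coe_toLinearMap, TensorAlgebra.tprod_apply, map_list_prod, List.map_ofFn,
    Function.comp_def] at h
  have h1 : ∑ s : Finset (Fin n), ((-1 : ℤ) ^ s.card) • ι k (∑ i ∈ s, v i) ^ n ∈
      Submodule.span k (Set.range fun y : L => ι k y ^ n) :=
    Submodule.sum_mem _ fun s _ => zsmul_mem (Submodule.subset_span (Set.mem_range_self _)) _
  have h2 : ((-1 : ℤ) ^ n) • (((-1 : ℤ) ^ n) •
      ∑ σ : Equiv.Perm (Fin n), (List.ofFn fun i => ι k (v (σ i))).prod) =
      ∑ σ : Equiv.Perm (Fin n), (List.ofFn fun i => ι k (v (σ i))).prod := by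
    rw [smul_smul, ← mul_pow]; simp
  rw [← h2]
  rw [h] at h1
  exact zsmul_mem h1 _

variable [CharZero k]

theorem list_prod_mem_span_pow (l : List L) : (l.map (ι k)).prod ∈
    Submodule.span k {u | ∃ (n : ℕ) (y : L), u = ι k y ^ n} := by
  -- The empty product has no factor in the ideal `⊤`, so it is treated apart, as a zeroth power.
  rcases l with _ | ⟨x, l⟩
  · exact Submodule.subset_span ⟨0, 0, by simp⟩
  · refine list_prod_mem_of_symmetrized_mem ⊤ _ (fun n v _ => ?_) _ ⟨x, by simp, trivial⟩
    refine Submodule.span_mono ?_ (symmetrized_mem_span_pow v)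
    rintro _ ⟨y, rfl⟩
    exact ⟨n, y, rfl⟩

variable (k L) in
/-- In characteristic zero, `U(L)` is spanned by the powers of the elements of `L`. -/
theorem span_pow_eq_top :
    Submodule.span k {u | ∃ (n : ℕ) (y : L), u = ι k y ^ n} =
      (⊤ : Submodule k (UniversalEnvelopingAlgebra k L)) := by
  rw [eq_top_iff, ← UniversalEnvelopingAlgebra.span_list_prod, Submodule.span_le]
  rintro _ ⟨l, rfl⟩
  exact list_prod_mem_span_pow l

/-- The Eulerian idempotent maps a product with a factor in the Lie ideal `R` to `R`. -/
theorem eulerian_list_prod_mem (R : LieIdeal k L) (l : List L) (hl : ∃ x ∈ l, x ∈ R) :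
    ∃ r ∈ R, eulerian k L (l.map (ι k)).prod = ι k r := by
  suffices h : (l.map (ι k)).prod ∈ Submodule.comap (eulerian k L) (Submodule.map
      (ι k : L →ₗ⁅k⁆ UniversalEnvelopingAlgebra k L).toLinearMap R.toSubmodule) by
    obtain ⟨r, hr, h⟩ := h
    exact ⟨r, hr, h.symm⟩
  refine list_prod_mem_of_symmetrized_mem R _ (fun n v hv => ?_) l hl
  rw [Submodule.mem_comap]
  -- For `n = 1` the only factor lies in `R` and is fixed by `e`; otherwise the symmetrized product
  -- is a combination of `n`-th powers, which `e` kills.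
  by_cases hn : n = 1
  · subst hn
    obtain ⟨i, hi⟩ := hv
    refine ⟨v i, hi, ?_⟩
    simp [-ι_apply, eulerian_ι, Subsingleton.elim i 0]
  · have h := symmetrized_mem_span_pow (k := k) v
    have h0 : Submodule.span k (Set.range fun y : L => ι k y ^ n) ≤
        LinearMap.ker (eulerian k L) := by
      refine Submodule.span_le.2 ?_
      rintro _ ⟨y, rfl⟩
      simp [-ι_apply, eulerian_ι_pow, hn]
    rw [LinearMap.mem_ker.1 (h0 h)]
    exact Submodule.zero_mem _

end EulerPBW

/-! ### Injectivity for free Lie algebras -/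

namespace FreeLieAlgebra

section Injective

variable (k X : Type*) [Field k]

variable {k X} in
-- The universal property gives a map to `S` whose composite with the inclusion fixes the
-- generators, hence is the identity.
theorem lieSubalgebra_eq_top {S : LieSubalgebra k (FreeLieAlgebra k X)}
    (h : ∀ x, of k x ∈ S) : S = ⊤ := by
  refine eq_top_iff.2 fun y _ => ?_
  have : S.incl.comp (lift k fun x => (⟨of k x, h x⟩ : S)) = LieHom.id := by
    ext x; simp
  rw [← LieHom.id_apply (R := k) y, ← this]
  exact Subtype.prop _

/-- A representation of the free Lie algebra `F` on `F × k`, which extends the adjoint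
representation; `x ∈ X` maps `(f, c)` to `([x, f] + c x, 0)`. -/
def degreeRep : FreeLieAlgebra k X →ₗ⁅k⁆ Module.End k (FreeLieAlgebra k X × k) :=
  lift k fun x => (LinearMap.coprod (LieAlgebra.ad k _ (of k x))
    (LinearMap.toSpanSingleton k _ (of k x))).prod 0

/-- The derivation of the free Lie algebra that is the identity on the generators. -/
def degreeMap : FreeLieAlgebra k X →ₗ[k] FreeLieAlgebra k X :=
  LinearMap.fst k _ _ ∘ₗ (degreeRep k X).toLinearMap.flip (0, 1)

variable {k X}

/-- The elements that act by this formula form a Lie subalgebra containing the generators. -/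
theorem degreeRep_apply (y f : FreeLieAlgebra k X) (c : k) :
    degreeRep k X y (f, c) = (⁅y, f⁆ + c • degreeMap k X y, 0) := by
  let S : LieSubalgebra k (FreeLieAlgebra k X) :=
    { carrier := {y | ∀ f c, degreeRep k X y (f, c) = (⁅y, f⁆ + c • degreeMap k X y, 0)}
      zero_mem' := fun f c => by simp [Prod.zero_eq_mk]
      add_mem' := fun {y z} hy hz f c => by
        rw [map_add, LinearMap.add_apply, hy, hz]
        simp only [add_lie, map_add, smul_add, Prod.mk_add_mk, add_zero]
        congr 1; abel
      smul_mem' := fun a y hy f c => by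
        rw [map_smul, LinearMap.smul_apply, hy]
        simp only [smul_lie, map_smul, smul_add, Prod.smul_mk, smul_zero, smul_comm a c]
      lie_mem' := fun {y z} hy hz f c => by
        have h : ∀ f c, degreeRep k X ⁅y, z⁆ (f, c) =
            (⁅⁅y, z⁆, f⁆ + c • (⁅y, degreeMap k X z⁆ - ⁅z, degreeMap k X y⁆), 0) := by
          intro f c
          rw [LieHom.map_lie, LieRing.of_associative_ring_bracket, LinearMap.sub_apply,
            Module.End.mul_apply, Module.End.mul_apply, hy, hz, hy, hz]
          simp only [lie_add, lie_smul, zero_smul, add_zero, Prod.mk_sub_mk, sub_self, lie_lie,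
            smul_sub]
          congr 1; abel
        -- Evaluating the commutator at `(0, 1)` identifies the coefficient of `c`: this is the
        -- derivation rule.
        have h1 : degreeMap k X ⁅y, z⁆ = ⁅y, degreeMap k X z⁆ - ⁅z, degreeMap k X y⁆ := by
          change (degreeRep k X ⁅y, z⁆ (0, 1)).1 = _
          rw [h]; simp
        rw [h, h1] }
  have hS : S = ⊤ := lieSubalgebra_eq_top fun x f c => by
    simp [degreeRep, degreeMap]
  have : y ∈ S := hS ▸ LieSubalgebra.mem_top y
  exact this f c

theorem degreeMap_of (x : X) : degreeMap k X (of k x) = of k x := by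
  simp [degreeRep, degreeMap]

theorem degreeMap_lie (y z : FreeLieAlgebra k X) :
    degreeMap k X ⁅y, z⁆ = ⁅degreeMap k X y, z⁆ + ⁅y, degreeMap k X z⁆ := by
  change (degreeRep k X ⁅y, z⁆ (0, 1)).1 = _
  rw [LieHom.map_lie, LieRing.of_associative_ring_bracket, LinearMap.sub_apply,
    Module.End.mul_apply, Module.End.mul_apply]
  simp only [degreeRep_apply, lie_zero, zero_add, one_smul, zero_smul, add_zero, Prod.mk_sub_mk]
  rw [← lie_skew (degreeMap k X y) z]
  abel

/-- For a derivation, eigenvalues add under the bracket, so the sum `W` of the eigenspaces for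
positive integers is a subalgebra. It contains the generators, hence is everything. In
characteristic zero these eigenvalues are nonzero, and independence of eigenspaces makes the kernel
trivial. -/
theorem degreeMap_injective [CharZero k] : Function.Injective (degreeMap k X) := by
  set V : k → Submodule k (FreeLieAlgebra k X) := Module.End.eigenspace (degreeMap k X) with hV
  let W : Submodule k (FreeLieAlgebra k X) := ⨆ n : ℕ, V (n + 1)
  have hVV : ∀ (m n : ℕ), ∀ y ∈ V (m + 1), ∀ z ∈ V (n + 1), ⁅y, z⁆ ∈ W := by
    intro m n y hy z hz
    refine Submodule.mem_iSup_of_mem (m + 1 + n) ?_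
    rw [hV, Module.End.mem_eigenspace_iff] at *
    rw [degreeMap_lie, hy, hz, smul_lie, lie_smul, ← add_smul]
    congr 1; push_cast; ring
  have hW : ∀ y ∈ W, ∀ z ∈ W, ⁅y, z⁆ ∈ W := by
    intro y hy z hz
    induction hy using Submodule.iSup_induction' with
    | mem m y hy =>
      induction hz using Submodule.iSup_induction' with
      | mem n z hz => exact hVV m n y hy z hz
      | zero => rw [lie_zero]; exact W.zero_mem
      | add a b _ _ ha hb => rw [lie_add]; exact W.add_mem ha hb
    | zero => rw [zero_lie]; exact W.zero_mem
    | add a b _ _ ha hb => rw [add_lie]; exact W.add_mem ha hb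
  let S : LieSubalgebra k (FreeLieAlgebra k X) := { W with lie_mem' := fun hy hz => hW _ hy _ hz }
  have hS : S = ⊤ := lieSubalgebra_eq_top fun x =>
    Submodule.mem_iSup_of_mem 0 (Module.End.mem_eigenspace_iff.2 (by simp [degreeMap_of]))
  refine (injective_iff_map_eq_zero _).2 fun y hy => ?_
  have h0 : y ∈ V 0 := Module.End.mem_eigenspace_iff.2 (by simp [hy])
  have h1 : y ∈ ⨆ c ≠ 0, V c := by
    have : y ∈ W := (hS ▸ LieSubalgebra.mem_top y : y ∈ S)
    refine (iSup_le fun n => ?_ : W ≤ _) this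
    exact le_iSup₂_of_le (n + 1 : k) (by exact_mod_cast n.succ_ne_zero) le_rfl
  exact (Submodule.disjoint_def.1 ((Module.End.eigenspaces_iSupIndep (degreeMap k X)) 0)) y h0 h1

/-- The representation `degreeRep` factors through the enveloping algebra, so an element killed by
`ι` acts by zero and is killed by the injective `degreeMap`. -/
theorem ι_universalEnveloping_injective [CharZero k] :
    Function.Injective (UniversalEnvelopingAlgebra.ι k :
      FreeLieAlgebra k X → UniversalEnvelopingAlgebra k (FreeLieAlgebra k X)) := by
  refine (injective_iff_map_eq_zero _).2 fun y hy => degreeMap_injective (k := k) ?_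
  have h := UniversalEnvelopingAlgebra.lift_ι_apply k (degreeRep k X) y
  rw [hy, map_zero] at h
  have h1 := degreeRep_apply y 0 1
  rw [← h] at h1
  rw [map_zero]
  simpa using (congrArg Prod.fst h1).symm

end Injective

end FreeLieAlgebra

/-! ### Injectivity of `ι` -/

namespace EulerPBW

open UniversalEnvelopingAlgebra

section Quotient

variable {k L : Type*} [Field k] [LieRing L] [LieAlgebra k L]

/-- The two-sided ideal of `U(L)` generated by the Lie ideal `R`, as the span of the products
with a factor in `R`. -/
def idealSpan (R : LieIdeal k L) : Submodule k (UniversalEnvelopingAlgebra k L) :=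
  Submodule.span k {u | ∃ l : List L, (∃ x ∈ l, x ∈ R) ∧ u = (l.map (ι k)).prod}

theorem mul_mem_idealSpan (R : LieIdeal k L) (a : UniversalEnvelopingAlgebra k L)
    {u : UniversalEnvelopingAlgebra k L} (hu : u ∈ idealSpan R) :
    a * u ∈ idealSpan R ∧ u * a ∈ idealSpan R := by
  have ha : a ∈ Submodule.span k (Set.range fun l : List L => (l.map (ι k)).prod) := by
    rw [UniversalEnvelopingAlgebra.span_list_prod]; trivial
  induction ha using Submodule.span_induction with
  | mem a ha =>
    obtain ⟨m, rfl⟩ := ha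
    beta_reduce
    induction hu using Submodule.span_induction with
    | mem u hu =>
      obtain ⟨l, ⟨x, hx, hxR⟩, rfl⟩ := hu
      rw [← List.prod_append, ← List.map_append, ← List.prod_append, ← List.map_append]
      exact ⟨Submodule.subset_span ⟨_, ⟨x, List.mem_append_right _ hx, hxR⟩, rfl⟩,
        Submodule.subset_span ⟨_, ⟨x, List.mem_append_left _ hx, hxR⟩, rfl⟩⟩
    | zero => simp
    | add b c _ _ hb hc =>
      rw [mul_add, add_mul]
      exact ⟨Submodule.add_mem _ hb.1 hc.1, Submodule.add_mem _ hb.2 hc.2⟩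
    | smul r b _ hb =>
      rw [mul_smul_comm, smul_mul_assoc]
      exact ⟨Submodule.smul_mem _ r hb.1, Submodule.smul_mem _ r hb.2⟩
  | zero => simp
  | add b c _ _ hb hc =>
    rw [mul_add, add_mul]
    exact ⟨Submodule.add_mem _ hb.1 hc.1, Submodule.add_mem _ hb.2 hc.2⟩
  | smul r b _ hb =>
    rw [mul_smul_comm, smul_mul_assoc]
    exact ⟨Submodule.smul_mem _ r hb.1, Submodule.smul_mem _ r hb.2⟩

/-- `idealSpan R` as a left ideal. -/
def idealOf (R : LieIdeal k L) : Ideal (UniversalEnvelopingAlgebra k L) where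
  toAddSubmonoid := (idealSpan R).toAddSubmonoid
  smul_mem' a _ hu := (mul_mem_idealSpan R a hu).1

instance (R : LieIdeal k L) : (idealOf R).IsTwoSided where
  mul_mem_of_left b hu := (mul_mem_idealSpan R b hu).2

theorem ι_mem_idealOf (R : LieIdeal k L) {x : L} (hx : x ∈ R) : ι k x ∈ idealOf R :=
  Submodule.subset_span (R := k) ⟨[x], ⟨x, by simp, hx⟩, by simp⟩

/-- A surjective homomorphism of Lie algebras `q : L → M` induces an isomorphism of `U(M)` with the
quotient of `U(L)` by the ideal generated by the kernel of `q`; here, the part of this that concerns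
the elements of `L`. -/
theorem ι_mem_idealSpan_of_ι_map_eq_zero {M : Type*} [LieRing M] [LieAlgebra k M]
    (q : L →ₗ⁅k⁆ M) (hq : Function.Surjective q) {y : L} (hy : ι k (q y) = 0) :
    ι k y ∈ idealSpan q.ker := by
  set I := idealOf q.ker with hI
  -- The class modulo `I` depends only on the image under `q`; this makes `f` below a Lie
  -- homomorphism although the section `s` is merely a map of sets.
  have hmk : ∀ {a b : L}, q a = q b → Ideal.Quotient.mk I (ι k a) = Ideal.Quotient.mk I (ι k b) := by
    intro a b hab
    rw [Ideal.Quotient.mk_eq_mk_iff_sub_mem, ← map_sub]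
    exact ι_mem_idealOf _ (by rw [LieHom.mem_ker, map_sub, hab, sub_self])
  let s : M → L := Function.surjInv hq
  have hs : ∀ x, q (s x) = x := Function.surjInv_eq hq
  let f : M →ₗ⁅k⁆ UniversalEnvelopingAlgebra k L ⧸ I :=
    { toFun := fun x => Ideal.Quotient.mk I (ι k (s x))
      map_add' := fun x z => by
        rw [← map_add, ← map_add]; exact hmk (by rw [map_add, hs, hs, hs])
      map_smul' := fun c x => by
        have h : Ideal.Quotient.mk I (ι k (s (c • x))) = Ideal.Quotient.mk I (ι k (c • s x)) :=
          hmk (by rw [map_smul, hs, hs])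
        rw [h, map_smul]; rfl
      map_lie' := fun {x z} => by
        rw [LieRing.of_associative_ring_bracket, ← map_mul (Ideal.Quotient.mk I),
          ← map_mul (Ideal.Quotient.mk I), ← map_sub,
          ← LieRing.of_associative_ring_bracket, ← LieHom.map_lie]
        exact hmk (by rw [LieHom.map_lie, hs, hs, hs]) }
  have h := lift_ι_apply k f (q y)
  rw [hy, map_zero] at h
  have h1 : Ideal.Quotient.mk I (ι k y) = 0 := by
    rw [h]; exact hmk (hs (q y)).symm
  exact Ideal.Quotient.eq_zero_iff_mem.1 h1

end Quotient

variable (k L : Type*) [Field k] [CharZero k] [LieRing L] [LieAlgebra k L]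

/-- Present `L` as the free Lie algebra on its own elements modulo `q.ker`. If `ι x = 0`, the
generator of `x` lies in the ideal generated by the kernel. Applying `e`, which fixes that
generator, shows that it equals `ι r` with `r` in the kernel; injectivity in the free case then
gives `x = q r = 0`. -/
theorem ι_injective : Function.Injective (ι k : L → UniversalEnvelopingAlgebra k L) := by
  refine (injective_iff_map_eq_zero _).2 fun x hx => ?_
  let q : FreeLieAlgebra k L →ₗ⁅k⁆ L := FreeLieAlgebra.lift k id
  have hq : ∀ z, q (FreeLieAlgebra.of k z) = z := fun z => FreeLieAlgebra.lift_of_apply id z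
  have h := ι_mem_idealSpan_of_ι_map_eq_zero q (fun z => ⟨_, hq z⟩)
    (y := FreeLieAlgebra.of k x) (by rw [hq, hx])
  have h1 : idealSpan q.ker ≤ Submodule.comap (eulerian k (FreeLieAlgebra k L)) (Submodule.map
      (ι k : FreeLieAlgebra k L →ₗ⁅k⁆ _).toLinearMap q.ker.toSubmodule) := by
    refine Submodule.span_le.2 ?_
    rintro _ ⟨l, hl, rfl⟩
    obtain ⟨r, hr, hrl⟩ := eulerian_list_prod_mem q.ker l hl
    exact ⟨r, hr, hrl.symm⟩
  obtain ⟨r, hr, hrx⟩ := h1 h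
  rw [eulerian_ι] at hrx
  have h2 := FreeLieAlgebra.ι_universalEnveloping_injective hrx
  rw [← hq x, ← h2]
  exact hr

/-- The Eulerian idempotent as a linear map `U(L) → L`. -/
def eulerianToLie : UniversalEnvelopingAlgebra k L →ₗ[k] L :=
  (LinearEquiv.ofInjective (ι k : L →ₗ⁅k⁆ UniversalEnvelopingAlgebra k L).toLinearMap
    (ι_injective k L)).symm.toLinearMap ∘ₗ LinearMap.codRestrict _ (eulerian k L) (by
      suffices h : Submodule.span k {u | ∃ (n : ℕ) (y : L), u = ι k y ^ n} ≤
          Submodule.comap (eulerian k L) (LinearMap.range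
            (ι k : L →ₗ⁅k⁆ UniversalEnvelopingAlgebra k L).toLinearMap) from
        fun u => h ((span_pow_eq_top k L).symm ▸ Submodule.mem_top)
      refine Submodule.span_le.2 ?_
      rintro _ ⟨n, y, rfl⟩
      rw [SetLike.mem_coe, Submodule.mem_comap, eulerian_ι_pow]
      split_ifs
      · exact ⟨y, rfl⟩
      · exact Submodule.zero_mem _)

variable {k L}

theorem ι_eulerianToLie (u : UniversalEnvelopingAlgebra k L) :
    ι k (eulerianToLie k L u) = eulerian k L u :=
  congrArg Subtype.val (LinearEquiv.apply_symm_apply (LinearEquiv.ofInjective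
    (ι k : L →ₗ⁅k⁆ UniversalEnvelopingAlgebra k L).toLinearMap (ι_injective k L)) _)

theorem eulerianToLie_ι_pow (y : L) (n : ℕ) :
    eulerianToLie k L (ι k y ^ n) = if n = 1 then y else 0 := by
  apply ι_injective k L
  rw [ι_eulerianToLie, eulerian_ι_pow]
  split_ifs
  · rfl
  · rw [map_zero]

end EulerPBW

/-! ### Powers in the coalgebra of symmetrized tensors -/

namespace TensorAlgebra

section SymPow

open WithConv

variable {k V : Type*} [Field k] [CharZero k] [AddCommGroup V] [Module k V]

/-- The tensor `x ⊗ ⋯ ⊗ x` as an element of `Sym^c(V)`. -/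
def symPow (x : V) (n : ℕ) : symTensors k V := ⟨ι k x ^ n, ι_pow_mem_symTensors n x⟩

theorem symTensors_induction {p : symTensors k V → Prop} (pow : ∀ x n, p (symPow x n))
    (zero : p 0) (add : ∀ a b, p a → p b → p (a + b)) (smul : ∀ (c : k) a, p a → p (c • a))
    (t : symTensors k V) : p t := by
  obtain ⟨t, ht⟩ := t
  -- The span induction takes place in the tensor algebra, where `p` is not defined; hence the
  -- existential.
  have h : ∃ s : symTensors k V, (s : TensorAlgebra k V) = t ∧ p s := by
    replace ht := symTensors_le_span_pow ht
    induction ht using Submodule.span_induction with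
    | mem t ht =>
      obtain ⟨n, x, rfl⟩ := ht
      exact ⟨symPow x n, rfl, pow x n⟩
    | zero => exact ⟨0, rfl, zero⟩
    | add a b _ _ ha hb =>
      obtain ⟨a, rfl, ha⟩ := ha
      obtain ⟨b, rfl, hb⟩ := hb
      exact ⟨a + b, rfl, add a b ha hb⟩
    | smul c a ha' ha =>
      obtain ⟨a, rfl, ha⟩ := ha
      exact ⟨c • a, rfl, smul c a ha⟩
  obtain ⟨s, rfl, hs⟩ := h
  exact hs

/-- Under deconcatenation the plain tensor powers are already divided powers, without factorials. -/
theorem comul_symPow (x : V) (n : ℕ) : Coalgebra.comul (R := k) (symPow (k := k) x n) =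
    ∑ p ∈ Finset.HasAntidiagonal.antidiagonal n, symPow x p.1 ⊗ₜ[k] symPow x p.2 := by
  apply map_subtype_injective (k := k) (V := V)
  refine (map_subtype_symComul_apply k V _).trans ((deconc_ι_pow n x).trans ?_)
  rw [map_sum, Finset.Nat.sum_antidiagonal_eq_sum_range_succ_mk]
  rfl

theorem counit_symPow (x : V) (n : ℕ) :
    Coalgebra.counit (R := k) (symPow (k := k) x n) = if n = 0 then 1 else 0 := by
  change algebraMapInv (ι k x ^ n) = _
  rw [map_pow]
  split_ifs with h
  · simp [h]
  · simp [h, algebraMapInv]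

theorem symProj_symPow (x : V) (n : ℕ) :
    symProj k V (symPow x n) = if n = 1 then x else 0 := by
  change ιInv (ι k x ^ n) = _
  split_ifs with h
  · rw [h, pow_one]; exact ι_leftInverse x
  · rw [← tprod_const, ιInv_tprod k V h]

variable (k V) in
/-- The projection of `Sym^c(V)` to tensor degree one, with values in the tensor algebra. -/
def convProj : WithConv (symTensors k V →ₗ[k] TensorAlgebra k V) := toConv (ι k ∘ₗ symProj k V)

/-- On the powers of `x` the projection corresponds to the power series `X`, so its `m`-th
convolution power, `X ^ m`, selects degree `m`. -/
theorem convProj_pow_symPow (m n : ℕ) (x : V) :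
    (convProj k V ^ m) (symPow x n) = if n = m then ι k x ^ n else 0 := by
  rw [EulerPBW.convPow_apply_dividedPower (comul_symPow x) (counit_symPow x) (b := ι k x)
    (a := PowerSeries.X) (fun n => ?_), PowerSeries.coeff_X_pow, ite_smul, one_smul, zero_smul]
  change ι k (symProj k V (symPow x n)) = _
  rw [symProj_symPow, PowerSeries.coeff_X]
  split_ifs with h
  · rw [h, pow_one, one_smul]
  · rw [map_zero, zero_smul]

/-- An element of `Sym^c(V)` is the sum of its homogeneous components, which are its images under
the convolution powers of the projection to degree one. -/
theorem exists_sum_convProj_pow (t : symTensors k V) :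
    ∃ N, ∀ M, N ≤ M → ∑ m ∈ Finset.range M, (convProj k V ^ m) t = (t : TensorAlgebra k V) := by
  have hadd : ∀ m (a b : symTensors k V), (convProj k V ^ m) (a + b) =
    (convProj k V ^ m) a + (convProj k V ^ m) b := fun m => map_add (convProj k V ^ m).ofConv
  have hsmul : ∀ m (c : k) (a : symTensors k V), (convProj k V ^ m) (c • a) =
    c • (convProj k V ^ m) a := fun m => map_smul (convProj k V ^ m).ofConv
  induction t using symTensors_induction with
  | pow x n =>
    refine ⟨n + 1, fun M hM => ?_⟩
    simp only [convProj_pow_symPow]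
    rw [Finset.sum_ite_eq, if_pos (Finset.mem_range.2 hM)]
    rfl
  | zero => exact ⟨0, fun M _ => Finset.sum_eq_zero fun m _ => map_zero (convProj k V ^ m).ofConv⟩
  | add a b ha hb =>
    obtain ⟨N, hN⟩ := ha
    obtain ⟨N', hN'⟩ := hb
    refine ⟨max N N', fun M hM => ?_⟩
    simp only [hadd, Finset.sum_add_distrib]
    rw [hN M (by omega), hN' M (by omega)]
    rfl
  | smul c a ha =>
    obtain ⟨N, hN⟩ := ha
    refine ⟨N, fun M hM => ?_⟩
    simp only [hsmul, ← Finset.smul_sum]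
    rw [hN M hM]
    rfl

/-- A homomorphism of coalgebras to `Sym^c(V)` is determined by its component in degree one. -/
theorem coalgHom_ext_symProj {C : Type*} [AddCommGroup C] [Module k C] [Coalgebra k C]
    {φ ψ : C →ₗc[k] symTensors k V} (h : ∀ c, symProj k V (φ c) = symProj k V (ψ c)) (c : C) :
    φ c = ψ c := by
  obtain ⟨N, hN⟩ := exists_sum_convProj_pow (φ c)
  obtain ⟨N', hN'⟩ := exists_sum_convProj_pow (ψ c)
  have h1 : (convProj k V).ofConv ∘ₗ φ.toLinearMap = (convProj k V).ofConv ∘ₗ ψ.toLinearMap :=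
    LinearMap.ext fun c => congrArg (ι k) (h c)
  apply Subtype.ext
  -- A common bound lets the two sums of homogeneous components be compared term by term.
  rw [← hN (max N N') (le_max_left _ _), ← hN' (max N N') (le_max_right _ _)]
  refine Finset.sum_congr rfl fun m _ => ?_
  rw [EulerPBW.convPow_apply_coalgHom, EulerPBW.convPow_apply_coalgHom, h1]

end SymPow

end TensorAlgebra

/-! ### The symmetrization map -/

namespace EulerPBW

section Symmetrization

open UniversalEnvelopingAlgebra TensorAlgebra WithConv

open scoped Nat

variable (k L : Type*) [Field k] [LieRing L] [LieAlgebra k L]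

/-- The linear map `T(L) → U(L)` with `x₁ ⊗ ⋯ ⊗ xₙ ↦ (x₁⋯xₙ)/n!`. -/
def dividedProd : TensorAlgebra k L →ₗ[k] UniversalEnvelopingAlgebra k L :=
  -- The polynomial variable records the number of factors, so that the coefficient in degree `n`
  -- can be divided by `n!`.
  Polynomial.lsum (fun n => (n ! : k)⁻¹ • LinearMap.id) ∘ₗ
    (TensorAlgebra.lift k (A := Polynomial (UniversalEnvelopingAlgebra k L))
      ((Polynomial.monomial 1).restrictScalars k ∘ₗ
        (UniversalEnvelopingAlgebra.ι k :
          L →ₗ⁅k⁆ UniversalEnvelopingAlgebra k L).toLinearMap)).toLinearMap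

variable {k L} in
theorem dividedProd_ι_pow (x : L) (n : ℕ) : dividedProd k L (TensorAlgebra.ι k x ^ n) =
    (n ! : k)⁻¹ • UniversalEnvelopingAlgebra.ι k x ^ n := by
  simp [-ι_apply, dividedProd, Polynomial.monomial_pow, Polynomial.lsum_apply,
    Polynomial.sum_monomial_index]

variable [CharZero k]

/-- The symmetrization map `Sym^c(L) → U(L)`, with `x ⊗ ⋯ ⊗ x ↦ xⁿ/n!`. -/
def symmetrization : symTensors k L →ₗc[k] UniversalEnvelopingAlgebra k L where
  __ := dividedProd k L ∘ₗ (symTensors k L).subtype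
  counit_comp := by
    ext1 t
    induction t using symTensors_induction with
    | pow x n =>
      rw [counit_symPow, ← counit_dividedPower x n, ← dividedProd_ι_pow]
      rfl
    | zero => rw [map_zero, map_zero]
    | add a b ha hb => rw [map_add, map_add, ha, hb]
    | smul c a ha => rw [map_smul, map_smul, ha]
  map_comp_comul := by
    ext1 t
    induction t using symTensors_induction with
    | pow x n =>
      have h := comul_dividedPower (k := k) x n
      simp only [← dividedProd_ι_pow] at h
      rw [LinearMap.comp_apply, comul_symPow, map_sum]
      exact h.symm
    | zero => rw [map_zero, map_zero]
    | add a b ha hb => rw [map_add, map_add, ha, hb]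
    | smul c a ha => rw [map_smul, map_smul, ha]

variable {k L}

theorem symmetrization_symPow (x : L) (n : ℕ) : symmetrization k L (symPow x n) =
    (n ! : k)⁻¹ • UniversalEnvelopingAlgebra.ι k x ^ n :=
  dividedProd_ι_pow x n

/-- Both sides keep `x` in degree one and vanish on the other powers. This makes `e` the degree-one
component of the inverse of symmetrization. -/
theorem eulerianToLie_symmetrization (t : symTensors k L) :
    eulerianToLie k L (symmetrization k L t) = symProj k L t := by
  induction t using symTensors_induction with
  | pow x n =>
    rw [symmetrization_symPow, map_smul, eulerianToLie_ι_pow, symProj_symPow]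
    split_ifs with h
    · simp [h]
    · rw [smul_zero]
  | zero => simp only [map_zero]
  | add a b ha hb => simp only [map_add, ha, hb]
  | smul c a ha => simp only [map_smul, ha]

variable (k L)

theorem symmetrization_surjective : Function.Surjective (symmetrization k L) := by
  suffices h : LinearMap.range (symmetrization k L).toLinearMap = ⊤ from LinearMap.range_eq_top.1 h
  rw [eq_top_iff, ← span_pow_eq_top, Submodule.span_le]
  rintro _ ⟨n, y, rfl⟩
  refine ⟨(n ! : k) • symPow y n, ?_⟩
  rw [map_smul]
  refine (congrArg _ (symmetrization_symPow y n)).trans ?_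
  rw [smul_inv_smul₀ (Nat.cast_ne_zero.2 n.factorial_ne_zero)]

/-- The projection factors through symmetrization, hence so do its convolution powers. They vanish
at any `t` in the kernel, and `t` is the sum of its images under them. -/
theorem symmetrization_injective : Function.Injective (symmetrization k L) := by
  refine (injective_iff_map_eq_zero _).2 fun t ht => ?_
  obtain ⟨N, hN⟩ := exists_sum_convProj_pow t
  apply Subtype.ext
  rw [← hN N le_rfl]
  refine Finset.sum_eq_zero fun m _ => ?_
  have h : convProj k L = toConv ((TensorAlgebra.ι k ∘ₗ eulerianToLie k L) ∘ₗ
      (symmetrization k L).toLinearMap) :=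
    WithConv.ofConv_injective (LinearMap.ext fun t =>
      congrArg (TensorAlgebra.ι k) (eulerianToLie_symmetrization t).symm)
  have h1 := convPow_apply_coalgHom (toConv (TensorAlgebra.ι k ∘ₗ eulerianToLie k L))
    (symmetrization k L) m t
  rw [WithConv.ofConv_toConv, ← h, ht] at h1
  exact h1.symm.trans (map_zero ((toConv (TensorAlgebra.ι k ∘ₗ eulerianToLie k L)) ^ m).ofConv)

/-- The symmetrization map as an isomorphism of coalgebras. -/
def symmetrizationEquiv : symTensors k L ≃ₗc[k] UniversalEnvelopingAlgebra k L :=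
  CoalgEquiv.ofBijective ⟨symmetrization_injective k L, symmetrization_surjective k L⟩

end Symmetrization

end EulerPBW

end

theorem mainTheorem8 {k L : Type*} [Field k] [CharZero k] [LieRing L] [LieAlgebra k L] :
    Function.Injective (UniversalEnvelopingAlgebra.ι k : L → UniversalEnvelopingAlgebra k L) ∧
    ∃ e : UniversalEnvelopingAlgebra k L →ₗ[k] L,
      (∀ u, UniversalEnvelopingAlgebra.ι k (e u) = UniversalEnvelopingAlgebra.eulerian k L u) ∧
      ∃ α : UniversalEnvelopingAlgebra k L ≃ₗc[k] TensorAlgebra.symTensors k L,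
        (∀ u, TensorAlgebra.symProj k L (α u) = e u) ∧
        ∀ φ : UniversalEnvelopingAlgebra k L →ₗc[k] TensorAlgebra.symTensors k L,
          (∀ u, TensorAlgebra.symProj k L (φ u) = e u) → ∀ u, φ u = α u := by
  have hα : ∀ u, TensorAlgebra.symProj k L ((EulerPBW.symmetrizationEquiv k L).symm u) =
      EulerPBW.eulerianToLie k L u := fun u => by
    rw [← EulerPBW.eulerianToLie_symmetrization]
    exact congrArg _ ((EulerPBW.symmetrizationEquiv k L).apply_symm_apply u)
  refine ⟨EulerPBW.ι_injective k L, EulerPBW.eulerianToLie k L, EulerPBW.ι_eulerianToLie,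
    (EulerPBW.symmetrizationEquiv k L).symm, hα, fun φ hφ u => ?_⟩
  exact TensorAlgebra.coalgHom_ext_symProj (φ := φ)
    (ψ := ((EulerPBW.symmetrizationEquiv k L).symm : _ →ₗc[k] _))
    (fun u => (hφ u).trans (hα u).symm) u
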